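/- Let $n,d\ge 0$ be integers and let $Q\in\mathbb{R}^{dn\times dn}$ be a symmetric positive definite matrix, viewed as an $n\times n$ array of $d\times d$ blocks $Q_{[ij]}$, that is block-factorizable, $Q=U\bullet V$: there are matrices $U_1,\dots,U_n,V_1,\dots,V_n\in\mathbb{R}^{d\times d}$ with $$Q_{[ij]}=U_iV_j^\top\qquad\text{for all } 1\le i\le j\le n .$$ (Positive definiteness makes all matrices inverted below nonsingular.) For $x\in\mathbb{R}^{dn}$ let $x_{[i]}\in\mathbb{R}^d$ denote its $i$-th block, and put $$X^B_Q=\bigl\{(x,z,\tau)\in\mathbb{R}^{dn}\times\{0,1\}^n\times\mathbb{R}_+ :\ \tau\ge x^\top Qx,\ x_{[i]}(1-z_i)=0 \text{ for } i=1,\dots,n\bigr\}.$$ Let $E_i\in\mathbb{R}^{dn\times d}$ be the block column whose $i$-th block is the identity and whose other blocks are zero, and define $$\Lambda_{[i\to j]}=\bigl(E_i-E_jU_j^{-\top}U_i^\top\bigr)\bigl(U_iV_i^\top-U_iU_j^{-1}V_jU_i^\top\bigr)^{-1}\bigl(E_i-E_jU_j^{-\top}U_i^\top\bigr)^\top,\qquad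 1\le i<j\le n,$$ $$\Lambda_{[i\to n+1]}=E_i\bigl(U_iV_i^\top\bigr)^{-1}E_i^\top,\qquad 1\le i\le n .$$ Then $\operatorname{cl}\operatorname{conv}(X^B_Q)$ is exactly the set of all $(x,z,\tau)\in\mathbb{R}^{dn}\times\mathbb{R}^n\times\mathbb{R}$ for which there exist a matrix $W\in\mathbb{R}^{dn\times dn}$ and real numbers $w_{ij}\ge 0$ $(0\le i<j\le n+1)$ such that $$\begin{bmatrix}W&x\\x^\top&\tau\end{bmatrix}\succeq 0,$$ $$\sum_{i=0}^{\ell-1}w_{i\ell}-\sum_{j=\ell+1}^{n+1}w_{\ell j}=\begin{cases}-1,&\ell=0,\\ 1,&\ell=n+1,\\ 0,&\text{otherwise,}\end{cases}\qquad \ell=0,\dots,n+1,$$ $$z_\ell=\sum_{i=0}^{\ell-1}w_{i\ell}\quad(\ell=1,\dots,n),\qquad W=\sum_{i=1}^{n}\sum_{j=i+1}^{n+1}w_{ij}\,\Lambda_{[i\to j]} .$$ -/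

import Mathlib

open Matrix

namespace BlockFactorizable

/-! A block vector in `ℝ^(dn)` is indexed by pairs `(i, k)`, where `i : Fin n` is the block and
`k : Fin d` the position inside the block; block matrices are indexed likewise. -/

/-- The `(i, j)`-th `d × d` block of a `dn × dn` matrix. -/
def block {n d : ℕ} (Q : Matrix (Fin n × Fin d) (Fin n × Fin d) ℝ) (i j : Fin n) :
    Matrix (Fin d) (Fin d) ℝ :=
  Matrix.of fun k l => Q (i, k) (j, l)

/-- `Q = U • V` for two sequences of `d × d` matrices: `Q` is the symmetric matrix whose
`(i, j)`-th block is `U i * (V j)ᵀ` for all `i ≤ j`. -/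
def IsBlockFactorization {n d : ℕ} (Q : Matrix (Fin n × Fin d) (Fin n × Fin d) ℝ)
    (U V : Fin n → Matrix (Fin d) (Fin d) ℝ) : Prop :=
  Q.IsSymm ∧ ∀ i j : Fin n, i ≤ j → block Q i j = U i * (V j)ᵀ

/-- The mixed-integer epigraph set: triples `(x, z, τ)` with `z` binary, `τ ≥ 0`, `τ ≥ xᵀ Q x`,
and the `i`-th block of `x` equal to zero unless `z i = 1`. -/
def mixedIntegerSet {n d : ℕ} (Q : Matrix (Fin n × Fin d) (Fin n × Fin d) ℝ) :
    Set ((Fin n × Fin d → ℝ) × (Fin n → ℝ) × ℝ) :=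
  {p | (∀ i, p.2.1 i = 0 ∨ p.2.1 i = 1) ∧ 0 ≤ p.2.2 ∧ p.1 ⬝ᵥ (Q *ᵥ p.1) ≤ p.2.2 ∧
    ∀ i k, p.1 (i, k) * (1 - p.2.1 i) = 0}

/-- The `dn × d` block column with the identity as its `i`-th block and zeros elsewhere. -/
def blockUnit {n d : ℕ} (i : Fin n) : Matrix (Fin n × Fin d) (Fin d) ℝ :=
  Matrix.of fun p l => if p.1 = i ∧ p.2 = l then 1 else 0

/-- The matrix `Λ_[i → j]` for two indices `i < j` in `[n]`. -/
noncomputable def arcMatrix {n d : ℕ} (U V : Fin n → Matrix (Fin d) (Fin d) ℝ) (i j : Fin n) :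
    Matrix (Fin n × Fin d) (Fin n × Fin d) ℝ :=
  let G : Matrix (Fin n × Fin d) (Fin d) ℝ := blockUnit i - blockUnit j * (((U j)⁻¹)ᵀ * (U i)ᵀ)
  G * (U i * (V i)ᵀ - U i * (U j)⁻¹ * V j * (U i)ᵀ)⁻¹ * Gᵀ

/-- The matrix `Λ_[i → n+1]` for an index `i` in `[n]`. -/
noncomputable def sinkMatrix {n d : ℕ} (U V : Fin n → Matrix (Fin d) (Fin d) ℝ) (i : Fin n) :
    Matrix (Fin n × Fin d) (Fin n × Fin d) ℝ :=
  let E : Matrix (Fin n × Fin d) (Fin d) ℝ := blockUnit i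
  E * (U i * (V i)ᵀ)⁻¹ * Eᵀ

/-- The complete directed acyclic graph has nodes `0, …, n+1` (the type `Fin (n + 2)`) and arcs
`(i, j)` with `i < j`. The index `i : Fin n`, being the `(i+1)`-st element of `[n]`, is the inner
node with value `i + 1`. -/
def node {n : ℕ} (i : Fin n) : Fin (n + 2) := i.succ.castSucc

/-- The total flow on the arcs entering the node `l`. -/
def inflow {n : ℕ} (w : Fin (n + 2) → Fin (n + 2) → ℝ) (l : Fin (n + 2)) : ℝ :=
  ∑ i ∈ Finset.Iio l, w i l

/-- The total flow on the arcs leaving the node `l`. -/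
def outflow {n : ℕ} (w : Fin (n + 2) → Fin (n + 2) → ℝ) (l : Fin (n + 2)) : ℝ :=
  ∑ j ∈ Finset.Ioi l, w l j

/-- `w` is a nonnegative unit flow from node `0` to node `n+1`. Only the `(n+1)(n+2)/2` values
`w i j` on arcs, that is with `i < j`, are flow variables; here and below the other values of the
function `w` do not occur. -/
def IsPathFlow {n : ℕ} (w : Fin (n + 2) → Fin (n + 2) → ℝ) : Prop :=
  (∀ i j, i < j → 0 ≤ w i j) ∧
  ∀ l, inflow w l - outflow w l = if l = 0 then -1 else if l = Fin.last (n + 1) then 1 else 0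

/-- The sum of `w i j • Λ_[i → j]` over `1 ≤ i ≤ n` and `i + 1 ≤ j ≤ n + 1`, with the terms
`j ≤ n` and `j = n + 1` written separately. -/
noncomputable def flowMatrix {n d : ℕ} (U V : Fin n → Matrix (Fin d) (Fin d) ℝ)
    (w : Fin (n + 2) → Fin (n + 2) → ℝ) : Matrix (Fin n × Fin d) (Fin n × Fin d) ℝ :=
  ∑ i : Fin n, ((∑ j ∈ Finset.Ioi i, w (node i) (node j) • arcMatrix U V i j) +
    w (node i) (Fin.last (n + 1)) • sinkMatrix U V i)

/-- The bordered matrix `[[W, x], [xᵀ, τ]]`. -/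
def bordered {n d : ℕ} (W : Matrix (Fin n × Fin d) (Fin n × Fin d) ℝ)
    (x : Fin n × Fin d → ℝ) (τ : ℝ) :
    Matrix ((Fin n × Fin d) ⊕ Unit) ((Fin n × Fin d) ⊕ Unit) ℝ :=
  Matrix.fromBlocks W (Matrix.replicateCol Unit x) (Matrix.replicateRow Unit x)
    (Matrix.of fun _ _ => τ)

end BlockFactorizable

/-!
The key fact is that the matrix of a path is a padded inverse of a principal submatrix of `Q`. If `w` is the indicator of a
path from the source to the sink visiting the set `S` of inner nodes, then `flowMatrix U V w` is
`(Q_S)⁻¹` padded with zeros, where `Q_S` is the principal submatrix on the blocks in `S`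
(`IsPath.isPaddedInverse`). The proof adds the nodes of the path one at a time, from the sink
backwards. Factorizability says that beyond block `j` the block column `i` of `Q` is the block
column `j` times the constant matrix `U_j⁻ᵀ U_iᵀ`, so adding block `i` in front of block `j` has a
Schur complement that sees block `j` only, and the correction in the bordering formula
(`IsPaddedInverse.border`) is exactly the matrix of the arc from `i` to `j`.

Let `P` be the convex hull of the path indicators. Every unit flow agrees on the arcs with a point
of `P` (`IsPathFlow.exists_mem_convexHull`), so the right-hand side does not change when `w` is
confined to `P`; the resulting set is `pathFormulation U V`. It is convex, and it is closed because
`P` is compact (`isClosed_pathFormulation`). It contains each mixed-integer point `(x, z, τ)`: for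
the path through the support of `z`, with matrix `M`, one has `x = M (Q x)`.

Conversely, positive semidefiniteness of `[[W, x], [xᵀ, τ]]` means that `x = W y` and
`yᵀ W y ≤ τ` for some `y`. Writing `W = ∑ λ_P M_P` as a convex combination of path matrices gives
`x = ∑ λ_P x_P` with `x_P = M_P y`, and `x_Pᵀ Q x_P = yᵀ M_P Q M_P y = yᵀ M_P y` because `M_P` is a
padded inverse. Hence the triple is a convex combination of the mixed-integer points
`(x_P, 1_P, yᵀ M_P y + s)` with the common slack `s = τ - yᵀ W y`
(`pathFormulation_subset_convexHull`). In particular the convex hull is already closed.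
-/

namespace BlockFactorizable

/-! ### Paths and their indicator flows -/

/-- The flow of value one on the single arc `(i, j)`. -/
noncomputable def arcFlow {n : ℕ} (i j : Fin (n + 2)) : Fin (n + 2) → Fin (n + 2) → ℝ :=
  Pi.single i (Pi.single j 1)

lemma arcFlow_apply {n : ℕ} (i j a b : Fin (n + 2)) :
    arcFlow i j a b = if a = i ∧ b = j then 1 else 0 := by
  unfold arcFlow
  by_cases h : a = i
  · subst h; simp [Pi.single_apply]
  · simp [h]

/-- `IsPath l w` says that `w` is the indicator function of the arcs of a directed path from `l`
to the sink. -/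
inductive IsPath {n : ℕ} : Fin (n + 2) → (Fin (n + 2) → Fin (n + 2) → ℝ) → Prop
  | sink : IsPath (Fin.last (n + 1)) 0
  | cons {i j w} : i < j → IsPath j w → IsPath i (w + arcFlow i j)

lemma inflow_add {n : ℕ} (w w' : Fin (n + 2) → Fin (n + 2) → ℝ) (l : Fin (n + 2)) :
    inflow (w + w') l = inflow w l + inflow w' l := by
  simp [inflow, Finset.sum_add_distrib]

lemma outflow_add {n : ℕ} (w w' : Fin (n + 2) → Fin (n + 2) → ℝ) (l : Fin (n + 2)) :
    outflow (w + w') l = outflow w l + outflow w' l := by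
  simp [outflow, Finset.sum_add_distrib]

lemma inflow_smul {n : ℕ} (c : ℝ) (w : Fin (n + 2) → Fin (n + 2) → ℝ) (l : Fin (n + 2)) :
    inflow (c • w) l = c * inflow w l := by
  simp [inflow, Finset.mul_sum]

lemma outflow_smul {n : ℕ} (c : ℝ) (w : Fin (n + 2) → Fin (n + 2) → ℝ) (l : Fin (n + 2)) :
    outflow (c • w) l = c * outflow w l := by
  simp [outflow, Finset.mul_sum]

lemma inflow_arcFlow {n : ℕ} {i j : Fin (n + 2)} (h : i < j) (l : Fin (n + 2)) :
    inflow (arcFlow i j) l = if l = j then 1 else 0 := by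
  by_cases hl : l = j
  · subst hl; simp [inflow, arcFlow_apply, h]
  · simp [inflow, arcFlow_apply, hl]

lemma outflow_arcFlow {n : ℕ} {i j : Fin (n + 2)} (h : i < j) (l : Fin (n + 2)) :
    outflow (arcFlow i j) l = if l = i then 1 else 0 := by
  by_cases hl : l = i
  · subst hl; simp [outflow, arcFlow_apply, h]
  · simp [outflow, arcFlow_apply, hl]

lemma IsPath.apply_eq {n : ℕ} {l : Fin (n + 2)} {w : Fin (n + 2) → Fin (n + 2) → ℝ}
    (h : IsPath l w) (a b : Fin (n + 2)) : w a b = 0 ∨ w a b = 1 ∧ l ≤ a ∧ a < b := by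
  induction h with
  | sink => simp
  | @cons i j w hij _ ih =>
    simp only [Pi.add_apply, arcFlow_apply]
    by_cases hab : a = i ∧ b = j
    · obtain ⟨rfl, rfl⟩ := hab
      rcases ih with h0 | ⟨_, h1, _⟩
      · simp [h0, hij]
      · exact absurd h1 (not_le.mpr hij)
    · rcases ih with h0 | ⟨h0, h1, h2⟩
      · simp [h0, hab]
      · exact Or.inr ⟨by simp [h0, hab], hij.le.trans h1, h2⟩

lemma IsPath.eq_zero_of_last {n : ℕ} {w : Fin (n + 2) → Fin (n + 2) → ℝ}
    (h : IsPath (Fin.last (n + 1)) w) : w = 0 := by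
  ext a b
  rcases h.apply_eq a b with h0 | ⟨_, h1, h2⟩
  · exact h0
  · exact absurd (h2.trans_le (Fin.le_last b)) (not_lt.mpr h1)

lemma IsPath.outflow_of_lt {n : ℕ} {l k : Fin (n + 2)} {w : Fin (n + 2) → Fin (n + 2) → ℝ}
    (h : IsPath l w) (hk : k < l) : outflow w k = 0 :=
  Finset.sum_eq_zero fun b _ =>
    (h.apply_eq k b).resolve_right fun h' => absurd hk (not_lt.mpr h'.2.1)

lemma IsPath.outflow_start {n : ℕ} {l : Fin (n + 2)} {w : Fin (n + 2) → Fin (n + 2) → ℝ}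
    (h : IsPath l w) (hl : l ≠ Fin.last (n + 1)) : outflow w l = 1 := by
  cases h with
  | sink => exact absurd rfl hl
  | cons hij h => rw [outflow_add, h.outflow_of_lt hij, outflow_arcFlow hij]; simp

lemma IsPath.outflow_binary {n : ℕ} {l : Fin (n + 2)} {w : Fin (n + 2) → Fin (n + 2) → ℝ}
    (h : IsPath l w) (k : Fin (n + 2)) : outflow w k = 0 ∨ outflow w k = 1 := by
  induction h with
  | sink => simp [outflow]
  | @cons i j w hij h ih =>
    rw [outflow_add, outflow_arcFlow hij]
    by_cases hk : k = i
    · subst hk; simp [h.outflow_of_lt hij]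
    · simpa [hk] using ih

lemma IsPath.balance {n : ℕ} {l : Fin (n + 2)} {w : Fin (n + 2) → Fin (n + 2) → ℝ}
    (h : IsPath l w) (k : Fin (n + 2)) :
    inflow w k - outflow w k =
      (if k = Fin.last (n + 1) then 1 else 0) - if k = l then 1 else 0 := by
  induction h with
  | sink => simp [inflow, outflow]
  | cons hij _ ih =>
    rw [inflow_add, outflow_add, inflow_arcFlow hij, outflow_arcFlow hij]
    linarith

lemma IsPath.isPathFlow {n : ℕ} {w : Fin (n + 2) → Fin (n + 2) → ℝ} (h : IsPath 0 w) :
    IsPathFlow w := by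
  refine ⟨fun i j _ => ?_, fun l => ?_⟩
  · rcases h.apply_eq i j with h0 | ⟨h0, _⟩ <;> simp [h0]
  · rw [h.balance]
    by_cases h0 : l = 0
    · subst h0; simp [Fin.ext_iff]
    · simp [h0]

lemma setOf_isPath_finite {n : ℕ} (l : Fin (n + 2)) : {w | IsPath l w}.Finite := by
  have : (Set.univ.pi fun _ : Fin (n + 2) => Set.univ.pi fun _ : Fin (n + 2) =>
      ({0, 1} : Set ℝ)).Finite :=
    Set.Finite.pi fun _ => Set.Finite.pi fun _ => by simp
  refine this.subset fun w hw a _ b _ => ?_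
  rcases IsPath.apply_eq hw a b with h | ⟨h, _⟩ <;> simp [h]

/-- Every set of nodes is, beyond the starting node, the set of nodes visited by some path. -/
lemma exists_isPath_outflow_eq {n : ℕ} (S : Finset (Fin (n + 2))) (l : Fin (n + 2)) :
    ∃ w, IsPath l w ∧ ∀ k, l < k → k ≠ Fin.last (n + 1) →
      outflow w k = if k ∈ S then 1 else 0 := by
  induction l using WellFoundedGT.induction with
  | ind l ih =>
  by_cases hl : l = Fin.last (n + 1)
  · subst hl
    exact ⟨0, .sink, fun k hk => absurd (Fin.le_last k) (not_le.mpr hk)⟩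
  -- The path continues with the first node of `S` after `l`, or with the sink.
  let T := Finset.univ.filter fun k => l < k ∧ (k ∈ S ∨ k = Fin.last (n + 1))
  have hT : T.Nonempty := ⟨Fin.last (n + 1), by simp [T, Fin.lt_last_iff_ne_last, hl]⟩
  have hjT : T.min' hT ∈ T := T.min'_mem hT
  have hmin : ∀ k ∈ T, T.min' hT ≤ k := fun k hk => T.min'_le k hk
  generalize T.min' hT = j at hjT hmin
  simp only [T, Finset.mem_filter, Finset.mem_univ, true_and] at hjT hmin
  obtain ⟨w, hw, hwk⟩ := ih j hjT.1
  refine ⟨_, .cons hjT.1 hw, fun k hk hkl => ?_⟩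
  rw [outflow_add, outflow_arcFlow hjT.1, if_neg hk.ne', add_zero]
  rcases lt_trichotomy k j with hkj | rfl | hkj
  · rw [hw.outflow_of_lt hkj, if_neg]
    exact fun hS => absurd (hmin k ⟨hk, Or.inl hS⟩) (not_le.mpr hkj)
  · rw [hw.outflow_start hkl, if_pos (hjT.2.resolve_right hkl)]
  · exact hwk k hkj hkl

/-! ### Decomposition of flows into paths -/

/-- A random walk to the sink which leaves each node along an arc chosen with probability
proportional to `w`: `walkFlow w l` is its expected flow when started at `l`. At a node
other than the sink that `w` does not leave, the walk moves to the sink. -/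
noncomputable def walkFlow {n : ℕ} (w : Fin (n + 2) → Fin (n + 2) → ℝ) (l : Fin (n + 2)) :
    Fin (n + 2) → Fin (n + 2) → ℝ :=
  if outflow w l = 0 then
    if l = Fin.last (n + 1) then 0 else arcFlow l (Fin.last (n + 1))
  else
    ∑ j ∈ (Finset.Ioi l).attach,
      (w l j / outflow w l) • (walkFlow w j + arcFlow l j)
termination_by n + 2 - l.val
decreasing_by
  have := Finset.mem_Ioi.mp j.2
  have := j.1.isLt
  omega

lemma outflow_last {n : ℕ} (w : Fin (n + 2) → Fin (n + 2) → ℝ) :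
    outflow w (Fin.last (n + 1)) = 0 := by
  simp [outflow, ← Fin.top_eq_last]

lemma walkFlow_last {n : ℕ} (w : Fin (n + 2) → Fin (n + 2) → ℝ) :
    walkFlow w (Fin.last (n + 1)) = 0 := by
  rw [walkFlow]; simp [outflow_last]

lemma outflow_smul_walkFlow {n : ℕ} {w : Fin (n + 2) → Fin (n + 2) → ℝ}
    (hw : ∀ i j, i < j → 0 ≤ w i j) (l : Fin (n + 2)) :
    outflow w l • walkFlow w l = ∑ j ∈ Finset.Ioi l, w l j • (walkFlow w j + arcFlow l j) := by
  by_cases h : outflow w l = 0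
  · have h0 := (Finset.sum_eq_zero_iff_of_nonneg
      fun j hj => hw l j (Finset.mem_Ioi.mp hj)).mp h
    rw [h, zero_smul, Finset.sum_eq_zero fun j hj => by rw [h0 j hj, zero_smul]]
  · rw [walkFlow, if_neg h, Finset.smul_sum,
      Finset.sum_attach (Finset.Ioi l)
        fun j => outflow w l • (w l j / outflow w l) • (walkFlow w j + arcFlow l j)]
    refine Finset.sum_congr rfl fun j _ => ?_
    rw [smul_smul, mul_div_cancel₀ _ h]

lemma walkFlow_mem_convexHull {n : ℕ} {w : Fin (n + 2) → Fin (n + 2) → ℝ}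
    (hw : ∀ i j, i < j → 0 ≤ w i j) (l : Fin (n + 2)) :
    walkFlow w l ∈ convexHull ℝ {f | IsPath l f} := by
  induction l using WellFoundedGT.induction with
  | ind l ih =>
  rw [walkFlow]
  split_ifs with h hl
  · subst hl; exact subset_convexHull ℝ _ .sink
  · refine subset_convexHull ℝ _ ?_
    rw [← zero_add (arcFlow _ _)]
    exact .cons (Fin.lt_last_iff_ne_last.mpr hl) .sink
  · rw [Finset.sum_attach (Finset.Ioi l)
        fun j => (w l j / outflow w l) • (walkFlow w j + arcFlow l j)]
    refine (convex_convexHull ℝ _).sum_mem (fun j hj => ?_) ?_ fun j hj => ?_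
    · exact div_nonneg (hw l j (Finset.mem_Ioi.mp hj))
        (Finset.sum_nonneg fun k hk => hw l k (Finset.mem_Ioi.mp hk))
    · rw [← Finset.sum_div]; exact div_self h
    · have hlj := Finset.mem_Ioi.mp hj
      have hsub : {f | IsPath j f} ⊆
          (fun f => f + arcFlow l j) ⁻¹' convexHull ℝ {f | IsPath l f} :=
        fun f hf => subset_convexHull ℝ _ (.cons hlj hf)
      exact convexHull_min hsub ((convex_convexHull ℝ _).translate_preimage_left _) (ih j hlj)

/-- A unit flow agrees on the arcs with a convex combination of paths, namely with the expected
flow of the random walk started at the source. When the recursion for `walkFlow` is weighted at each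
node by the outflow of that node and summed up, the flow balance leaves only `walkFlow w 0`. -/
lemma IsPathFlow.exists_mem_convexHull {n : ℕ} {w : Fin (n + 2) → Fin (n + 2) → ℝ}
    (hw : IsPathFlow w) :
    ∃ f ∈ convexHull ℝ {f | IsPath 0 f}, ∀ a b, a < b → f a b = w a b := by
  refine ⟨walkFlow w 0, walkFlow_mem_convexHull hw.1 0, fun a b hab => ?_⟩
  have h1 : ∑ l, outflow w l • walkFlow w l =
      ∑ j, inflow w j • walkFlow w j + ∑ l, ∑ j ∈ Finset.Ioi l, w l j • arcFlow l j := by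
    simp_rw [outflow_smul_walkFlow hw.1, smul_add, Finset.sum_add_distrib, inflow, Finset.sum_smul]
    congr 1
    exact Finset.sum_comm' (by simp)
  have h2 : ∑ l, (inflow w l - outflow w l) • walkFlow w l = - walkFlow w 0 := by
    rw [Finset.sum_eq_single 0]
    · simp [hw.2]
    · intro l _ hl
      rw [hw.2, if_neg hl]
      split_ifs with h
      · rw [h, walkFlow_last, smul_zero]
      · rw [zero_smul]
    · simp
  have h3 : walkFlow w 0 = ∑ l, ∑ j ∈ Finset.Ioi l, w l j • arcFlow l j := by
    simp_rw [sub_smul, Finset.sum_sub_distrib] at h2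
    rw [h1] at h2
    symm
    simpa using h2
  rw [h3]
  simp only [Finset.sum_apply, Pi.smul_apply, arcFlow_apply, smul_eq_mul, mul_ite, mul_one,
    mul_zero]
  rw [Finset.sum_eq_single a (fun c _ hc => Finset.sum_eq_zero fun d _ => by simp [hc.symm])
      (by simp),
    Finset.sum_eq_single b (fun d _ hd => by simp [hd.symm]) (by simp [hab])]
  simp

/-! ### Inverses of principal submatrices -/

/-- For `S` a coordinate projection, `M` is the inverse of the principal submatrix of `Q` selected
by `S`, padded with zeros. -/
structure IsPaddedInverse {m : Type*} [Fintype m] (Q S M : Matrix m m ℝ) : Prop where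
  transpose_eq : Mᵀ = M
  supp_mul : S * M = M
  mul_mul_supp : M * Q * S = S

lemma IsPaddedInverse.mul_mul_self {m : Type*} [Fintype m] {Q S M : Matrix m m ℝ}
    (h : IsPaddedInverse Q S M) : M * Q * M = M := by
  conv_lhs => rw [← h.supp_mul, ← Matrix.mul_assoc, h.supp_mul, h.mul_mul_supp]
  exact h.supp_mul

/-- Inversion by bordering: the support is enlarged by the columns of `E`, and `E - H` spans the
`Q`-orthogonal complement of the old support in the new one. -/
lemma IsPaddedInverse.border {m k : Type*} [Fintype m] [DecidableEq m] [Fintype k] [DecidableEq k]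
    {Q S M : Matrix m m ℝ} {E H : Matrix m k ℝ} (h : IsPaddedInverse Q S M) (hQ : Q.PosDef)
    (hS : Sᵀ = S) (hE : Eᵀ * E = 1) (hSE : S * E = 0) (hSH : S * H = H)
    (hSQ : S * (Q * (E - H)) = 0) :
    IsPaddedInverse Q (S + E * Eᵀ) (M + (E - H) * (Eᵀ * (Q * (E - H)))⁻¹ * (E - H)ᵀ) := by
  have hQt : Qᵀ = Q := by simpa using hQ.isHermitian.eq
  have hES : Eᵀ * S = 0 := by
    have := congrArg Matrix.transpose hSE
    rwa [transpose_mul, hS, transpose_zero] at this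
  have hHS : Hᵀ * S = Hᵀ := by
    have := congrArg Matrix.transpose hSH
    rwa [transpose_mul, hS] at this
  have hMS : M * S = M := by
    have := congrArg Matrix.transpose h.supp_mul
    rwa [transpose_mul, hS, h.transpose_eq] at this
  have hEH : Eᵀ * H = 0 := by rw [← hSH, ← Matrix.mul_assoc, hES, Matrix.zero_mul]
  -- The Schur complement is a congruence transform of `Q`, hence positive definite and invertible.
  have hC : (E - H)ᵀ * Q * (E - H) = Eᵀ * (Q * (E - H)) := by
    rw [transpose_sub, Matrix.sub_mul, Matrix.sub_mul, ← hHS, Matrix.mul_assoc (Hᵀ * S),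
      Matrix.mul_assoc Hᵀ, hSQ, Matrix.mul_zero, sub_zero, Matrix.mul_assoc]
  have hEG : Eᵀ * (E - H) = 1 := by rw [Matrix.mul_sub, hE, hEH, sub_zero]
  have hSG : S * (E - H) = -H := by rw [Matrix.mul_sub, hSE, hSH, zero_sub]
  have hinj : Function.Injective (E - H).mulVec := by
    intro a b hab
    have := congrArg (fun v => Eᵀ *ᵥ v) hab
    simpa [mulVec_mulVec, hEG] using this
  have hCpos : (Eᵀ * (Q * (E - H))).PosDef := by
    rw [← hC]
    simpa using hQ.conjTranspose_mul_mul_same hinj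
  have hMQE : M * Q * E = H := by
    have h1 : M * Q * (E - H) = 0 := by
      rw [Matrix.mul_assoc, ← hMS, Matrix.mul_assoc, hSQ, Matrix.mul_zero]
    have h2 : M * Q * H = H := by
      conv_lhs => rw [← hSH, ← Matrix.mul_assoc, h.mul_mul_supp]
      exact hSH
    rw [Matrix.mul_sub, h2] at h1
    exact sub_eq_zero.mp h1
  have hGQS : (E - H)ᵀ * Q * S = 0 := by
    have := congrArg Matrix.transpose hSQ
    rwa [transpose_mul, transpose_mul, hS, hQt, transpose_zero] at this
  have hCt : (Eᵀ * (Q * (E - H)))ᵀ = Eᵀ * (Q * (E - H)) := by simpa using hCpos.isHermitian.eq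
  have hGQE : (E - H)ᵀ * Q * E = Eᵀ * (Q * (E - H)) := by
    rw [← hCt, transpose_mul, transpose_mul, hQt, transpose_transpose]
  have hdet : IsUnit (Eᵀ * (Q * (E - H))).det := (isUnit_iff_isUnit_det _).mp hCpos.isUnit
  generalize Eᵀ * (Q * (E - H)) = C at *
  generalize hG : E - H = G at *
  refine ⟨?_, ?_, ?_⟩
  · rw [transpose_add, h.transpose_eq, transpose_mul, transpose_mul, transpose_transpose,
      transpose_nonsing_inv, hCt, Matrix.mul_assoc]
  · have hEM : Eᵀ * M = 0 := by rw [← h.supp_mul, ← Matrix.mul_assoc, hES, Matrix.zero_mul]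
    have h1 : (S + E * Eᵀ) * G = G := by
      rw [Matrix.add_mul, Matrix.mul_assoc, hEG, hSG, Matrix.mul_one, ← hG]; abel
    have h2 : (S + E * Eᵀ) * M = M := by
      rw [Matrix.add_mul, Matrix.mul_assoc, hEM, h.supp_mul, Matrix.mul_zero, add_zero]
    rw [Matrix.mul_add, h2, ← Matrix.mul_assoc, ← Matrix.mul_assoc, h1]
  · have h1 : (M + G * C⁻¹ * Gᵀ) * Q * S = S := by
      rw [Matrix.add_mul, Matrix.add_mul, h.mul_mul_supp, Matrix.mul_assoc (G * C⁻¹),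
        Matrix.mul_assoc (G * C⁻¹), hGQS, Matrix.mul_zero, add_zero]
    have h2 : (M + G * C⁻¹ * Gᵀ) * Q * E = E := by
      rw [Matrix.add_mul, Matrix.add_mul, hMQE, Matrix.mul_assoc (G * C⁻¹),
        Matrix.mul_assoc (G * C⁻¹), hGQE, Matrix.mul_assoc G, nonsing_inv_mul _ hdet,
        Matrix.mul_one, ← hG]
      abel
    rw [Matrix.mul_add, h1, ← Matrix.mul_assoc, h2]

/-! ### Block columns -/

variable {n d : ℕ}

lemma mul_blockUnit_apply (Q : Matrix (Fin n × Fin d) (Fin n × Fin d) ℝ) (i k : Fin n)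
    (a b : Fin d) : (Q * blockUnit (d := d) i) (k, a) b = block Q k i a b := by
  simp [Matrix.mul_apply, blockUnit, block, Fintype.sum_prod_type, ite_and]

lemma transpose_blockUnit_mul_apply {l : Type*} (i : Fin n)
    (A : Matrix (Fin n × Fin d) l ℝ) (a : Fin d) (b : l) :
    ((blockUnit (d := d) i)ᵀ * A) a b = A (i, a) b := by
  simp [Matrix.mul_apply, blockUnit, Fintype.sum_prod_type, ite_and]

lemma transpose_blockUnit_mul_self (i : Fin n) :
    (blockUnit (d := d) i)ᵀ * blockUnit (d := d) i = 1 := by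
  ext a b
  rw [transpose_blockUnit_mul_apply]
  simp [blockUnit, Matrix.one_apply]

lemma blockUnit_mul_transpose_self (i : Fin n) :
    blockUnit (d := d) i * (blockUnit (d := d) i)ᵀ =
      diagonal fun p => if p.1 = i then 1 else 0 := by
  ext ⟨k, a⟩ ⟨l, b⟩
  simp only [Matrix.mul_apply, blockUnit, transpose_apply, of_apply, diagonal_apply, Prod.mk.injEq]
  rcases eq_or_ne k i with rfl | hk
  · rcases eq_or_ne l k with rfl | hl
    · simp
    · simp [hl, hl.symm]
  · simp [hk]

lemma diagonal_mul_blockUnit (z : Fin n → ℝ) (i : Fin n) :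
    diagonal (fun p : Fin n × Fin d => z p.1) * blockUnit (d := d) i =
      z i • blockUnit (d := d) i := by
  ext ⟨k, a⟩ b
  rcases eq_or_ne k i with rfl | hk
  · simp [blockUnit]
  · simp [blockUnit, hk]

/-! ### The matrices of arcs -/

section Factorization

variable {Q : Matrix (Fin n × Fin d) (Fin n × Fin d) ℝ} {U V : Fin n → Matrix (Fin d) (Fin d) ℝ}

lemma IsBlockFactorization.block_of_le (h : IsBlockFactorization Q U V) {i k : Fin n}
    (hik : i ≤ k) : block Q k i = V k * (U i)ᵀ := by
  have : block Q k i = (block Q i k)ᵀ := by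
    ext a b
    exact (h.1.apply (k, a) (i, b)).symm
  rw [this, h.2 i k hik, transpose_mul, transpose_transpose]

lemma IsBlockFactorization.isUnit_det (h : IsBlockFactorization Q U V) (hQ : Q.PosDef)
    (j : Fin n) : IsUnit (U j).det := by
  have h1 : (block Q j j).PosDef :=
    hQ.submatrix (e := fun a : Fin d => (j, a)) fun a b hab => by simpa using hab
  have h2 := (isUnit_iff_isUnit_det _).mp h1.isUnit
  rw [h.2 j j le_rfl, det_mul] at h2
  exact isUnit_of_mul_isUnit_left h2

/-- Below block `j`, the block column `i` of `Q` is the block column `j` times a fixed matrix. -/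
lemma IsBlockFactorization.mul_blockUnit_sub_apply (h : IsBlockFactorization Q U V)
    (hQ : Q.PosDef) {i j k : Fin n} (hij : i ≤ j) (hjk : j ≤ k) (a b : Fin d) :
    (Q * (blockUnit (d := d) i - blockUnit (d := d) j * (((U j)⁻¹)ᵀ * (U i)ᵀ))) (k, a) b = 0 := by
  have h1 : ∀ (A : Matrix (Fin d) (Fin d) ℝ), (Q * (blockUnit (d := d) j * A)) (k, a) b =
      (block Q k j * A) a b := by
    intro A
    rw [← Matrix.mul_assoc, Matrix.mul_apply, Matrix.mul_apply]
    simp_rw [mul_blockUnit_apply]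
  have h2 : (U j)ᵀ * ((U j)⁻¹)ᵀ = 1 := by
    rw [← transpose_mul, nonsing_inv_mul _ (h.isUnit_det hQ j), transpose_one]
  rw [Matrix.mul_sub, Matrix.sub_apply, h1, mul_blockUnit_apply, h.block_of_le (hij.trans hjk),
    h.block_of_le hjk, Matrix.mul_assoc, ← Matrix.mul_assoc (U j)ᵀ, h2, Matrix.one_mul, sub_self]

/-- The matrix inverted in `arcMatrix` is the Schur complement of block `j` in blocks `i, j`. -/
lemma IsBlockFactorization.schur_eq (h : IsBlockFactorization Q U V) (hQ : Q.PosDef)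
    {i j : Fin n} (hij : i ≤ j) :
    (blockUnit (d := d) i)ᵀ *
        (Q * (blockUnit (d := d) i - blockUnit (d := d) j * (((U j)⁻¹)ᵀ * (U i)ᵀ))) =
      U i * (V i)ᵀ - U i * (U j)⁻¹ * V j * (U i)ᵀ := by
  have h1 : ∀ l : Fin n, (blockUnit (d := d) i)ᵀ * (Q * blockUnit (d := d) l) = block Q i l := by
    intro l
    ext a b
    rw [transpose_blockUnit_mul_apply, mul_blockUnit_apply]
  have hU := h.isUnit_det hQ j
  have h2 : (V j)ᵀ * ((U j)⁻¹)ᵀ = (U j)⁻¹ * V j := by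
    have h3 : U j * (V j)ᵀ = V j * (U j)ᵀ := by rw [← h.2 j j le_rfl, h.block_of_le le_rfl]
    calc (V j)ᵀ * ((U j)⁻¹)ᵀ = (U j)⁻¹ * (U j * (V j)ᵀ) * ((U j)⁻¹)ᵀ := by
          rw [← Matrix.mul_assoc, nonsing_inv_mul _ hU, Matrix.one_mul]
      _ = (U j)⁻¹ * V j * ((U j)⁻¹ * U j)ᵀ := by
          rw [h3, transpose_mul]; simp only [Matrix.mul_assoc]
      _ = (U j)⁻¹ * V j := by rw [nonsing_inv_mul _ hU, transpose_one, Matrix.mul_one]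
  rw [Matrix.mul_sub, Matrix.mul_sub, h1, ← Matrix.mul_assoc Q, ← Matrix.mul_assoc _ (Q * _), h1,
    h.2 i i le_rfl, h.2 i j hij, Matrix.mul_assoc (U i), ← Matrix.mul_assoc (V j)ᵀ, h2]
  simp only [Matrix.mul_assoc]

end Factorization

lemma node_lt_node {i j : Fin n} : node i < node j ↔ i < j := by
  simp [node]

lemma node_inj {i j : Fin n} : node i = node j ↔ i = j := by
  simp [node]

lemma zero_lt_node (i : Fin n) : 0 < node i := by
  simp [node, Fin.lt_def]

lemma node_lt_last (i : Fin n) : node i < Fin.last (n + 1) := by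
  simp [node, Fin.lt_def]

lemma eq_zero_or_node_or_last (k : Fin (n + 2)) :
    k = 0 ∨ (∃ i, k = node i) ∨ k = Fin.last (n + 1) := by
  induction k using Fin.lastCases with
  | last => simp
  | cast k =>
    induction k using Fin.cases with
    | zero => simp
    | succ i => exact Or.inr (Or.inl ⟨i, rfl⟩)

lemma flowMatrix_add (U V : Fin n → Matrix (Fin d) (Fin d) ℝ)
    (w w' : Fin (n + 2) → Fin (n + 2) → ℝ) :
    flowMatrix U V (w + w') = flowMatrix U V w + flowMatrix U V w' := by
  simp only [flowMatrix, ← Finset.sum_add_distrib, Pi.add_apply, add_smul]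
  refine Finset.sum_congr rfl fun i _ => ?_
  rw [Finset.sum_add_distrib]
  abel

lemma flowMatrix_smul (U V : Fin n → Matrix (Fin d) (Fin d) ℝ) (c : ℝ)
    (w : Fin (n + 2) → Fin (n + 2) → ℝ) :
    flowMatrix U V (c • w) = c • flowMatrix U V w := by
  simp only [flowMatrix, Finset.smul_sum, smul_add, Pi.smul_apply, smul_smul, smul_eq_mul]

lemma flowMatrix_zero (U V : Fin n → Matrix (Fin d) (Fin d) ℝ) : flowMatrix U V 0 = 0 := by
  simp [flowMatrix]

lemma flowMatrix_arcFlow_zero (U V : Fin n → Matrix (Fin d) (Fin d) ℝ) (j : Fin (n + 2)) :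
    flowMatrix U V (arcFlow 0 j) = 0 := by
  simp [flowMatrix, arcFlow_apply, (zero_lt_node _).ne']

lemma flowMatrix_arcFlow_node (U V : Fin n → Matrix (Fin d) (Fin d) ℝ) {i j : Fin n}
    (hij : i < j) : flowMatrix U V (arcFlow (node i) (node j)) = arcMatrix U V i j := by
  simp [flowMatrix, arcFlow_apply, node_inj, (node_lt_last _).ne', ite_and, hij]

lemma flowMatrix_arcFlow_last (U V : Fin n → Matrix (Fin d) (Fin d) ℝ) (i : Fin n) :
    flowMatrix U V (arcFlow (node i) (Fin.last (n + 1))) = sinkMatrix U V i := by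
  simp [flowMatrix, arcFlow_apply, node_inj, (node_lt_last _).ne]

/-- The matrix of a path is the inverse of the principal submatrix of `Q` on the blocks visited by
the path: each arc contributes one step of the bordering method. -/
lemma IsPath.isPaddedInverse {Q : Matrix (Fin n × Fin d) (Fin n × Fin d) ℝ}
    {U V : Fin n → Matrix (Fin d) (Fin d) ℝ} (hQ : Q.PosDef) (hUV : IsBlockFactorization Q U V)
    {l : Fin (n + 2)} {w : Fin (n + 2) → Fin (n + 2) → ℝ} (h : IsPath l w) :
    IsPaddedInverse Q (diagonal fun p => outflow w (node p.1)) (flowMatrix U V w) := by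
  induction h with
  | sink =>
    rw [flowMatrix_zero]
    have : (diagonal fun p : Fin n × Fin d => outflow (0 : Fin (n + 2) → Fin (n + 2) → ℝ)
        (node p.1)) = 0 := by ext; simp [outflow]
    rw [this]
    exact ⟨by simp, by simp, by simp⟩
  | @cons k l w hkl h ih =>
    have hdiag : (diagonal fun p : Fin n × Fin d => outflow (w + arcFlow k l) (node p.1)) =
        (diagonal fun p => outflow w (node p.1)) +
          diagonal fun p => if node p.1 = k then 1 else 0 := by
      rw [diagonal_add]
      simp_rw [outflow_add, outflow_arcFlow hkl]
    rw [hdiag, flowMatrix_add]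
    rcases eq_zero_or_node_or_last k with rfl | ⟨i, rfl⟩ | rfl
    · simpa [flowMatrix_arcFlow_zero, (zero_lt_node _).ne'] using ih
    · have hi : outflow w (node i) = 0 := h.outflow_of_lt hkl
      have hSE := diagonal_mul_blockUnit (d := d) (fun i => outflow w (node i)) i
      rw [hi, zero_smul] at hSE
      simp_rw [node_inj]
      rw [← blockUnit_mul_transpose_self]
      rcases eq_zero_or_node_or_last l with rfl | ⟨j, rfl⟩ | rfl
      · exact absurd hkl (by simp)
      · have hij := node_lt_node.mp hkl
        rw [flowMatrix_arcFlow_node _ _ hij]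
        have hj : outflow w (node j) = 1 := h.outflow_start (node_lt_last j).ne
        have hSj := diagonal_mul_blockUnit (d := d) (fun i => outflow w (node i)) j
        rw [hj, one_smul] at hSj
        have := ih.border (H := blockUnit (d := d) j * (((U j)⁻¹)ᵀ * (U i)ᵀ)) hQ
          (diagonal_transpose _) (transpose_blockUnit_mul_self i) hSE
          (by rw [← Matrix.mul_assoc, hSj]) ?_
        · rwa [hUV.schur_eq hQ hij.le] at this
        · ext ⟨k, a⟩ b
          rw [diagonal_mul, Matrix.zero_apply]
          rcases lt_or_ge k j with hkj | hkj
          · rw [h.outflow_of_lt (node_lt_node.mpr hkj), zero_mul]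
          · rw [hUV.mul_blockUnit_sub_apply hQ hij.le hkj, mul_zero]
      · have hw := h.eq_zero_of_last
        rw [flowMatrix_arcFlow_last]
        have := ih.border (H := 0) hQ (diagonal_transpose _)
          (transpose_blockUnit_mul_self i) hSE (Matrix.mul_zero _) ?_
        · have hC : (blockUnit (d := d) i)ᵀ * (Q * blockUnit (d := d) i) = U i * (V i)ᵀ := by
            ext a b
            rw [transpose_blockUnit_mul_apply, mul_blockUnit_apply, hUV.2 i i le_rfl]
          rw [sub_zero, hC] at this
          exact this
        · ext
          simp [hw, outflow]
    · exact absurd hkl (not_lt.mpr (Fin.le_last l))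

/-! ### Bordered positive semidefinite matrices -/

lemma sumElim_dotProduct_bordered_mulVec (W : Matrix (Fin n × Fin d) (Fin n × Fin d) ℝ)
    (x u : Fin n × Fin d → ℝ) (τ t : ℝ) :
    Sum.elim u (fun _ => t) ⬝ᵥ bordered W x τ *ᵥ Sum.elim u (fun _ => t) =
      u ⬝ᵥ W *ᵥ u + 2 * t * (x ⬝ᵥ u) + t ^ 2 * τ := by
  have h1 : replicateCol Unit x *ᵥ (fun _ => t) = t • x := by
    ext p; simp [mulVec, dotProduct, mul_comm]
  have h2 : replicateRow Unit x *ᵥ u = fun _ => x ⬝ᵥ u := by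
    ext p; simp [mulVec]
  have h3 : (of fun _ _ => τ : Matrix Unit Unit ℝ) *ᵥ (fun _ => t) = fun _ => τ * t := by
    ext p; simp [mulVec, dotProduct]
  rw [bordered, fromBlocks_mulVec]
  simp only [Sum.elim_comp_inl, Sum.elim_comp_inr]
  rw [sumElim_dotProduct_sumElim, h1, h2, h3, dotProduct_add, dotProduct_smul, dotProduct_comm u x]
  simp [dotProduct]
  ring

lemma dotProduct_mulVec_comm_of_transpose_eq {m : Type*} [Fintype m] {W : Matrix m m ℝ}
    (hW : Wᵀ = W) (u v : m → ℝ) : u ⬝ᵥ W *ᵥ v = v ⬝ᵥ W *ᵥ u := by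
  rw [dotProduct_mulVec, ← mulVec_transpose, hW, dotProduct_comm]

/-- In the quadratic form of the bordered matrix, `t` times the border is absorbed by completing
the square. -/
lemma posSemidef_bordered_mulVec {W : Matrix (Fin n × Fin d) (Fin n × Fin d) ℝ}
    (hW : W.PosSemidef) (y : Fin n × Fin d → ℝ) {τ : ℝ} (hτ : y ⬝ᵥ W *ᵥ y ≤ τ) :
    (bordered W (W *ᵥ y) τ).PosSemidef := by
  have hWt : Wᵀ = W := by simpa using hW.isHermitian.eq
  refine PosSemidef.of_dotProduct_mulVec_nonneg ?_ fun v => ?_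
  · rw [Matrix.IsHermitian, bordered, conjTranspose_eq_transpose_of_trivial, fromBlocks_transpose,
      hWt]
    rfl
  · obtain ⟨u, t, rfl⟩ : ∃ u t, v = Sum.elim u (fun _ => t) :=
      ⟨v ∘ Sum.inl, v (Sum.inr ()), by ext (i | i) <;> rfl⟩
    rw [star_trivial, sumElim_dotProduct_bordered_mulVec]
    have h1 := hW.dotProduct_mulVec_nonneg (u + t • y)
    rw [star_trivial, mulVec_add, mulVec_smul, add_dotProduct, dotProduct_add, dotProduct_add,
      smul_dotProduct, smul_dotProduct, dotProduct_smul, dotProduct_smul,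
      dotProduct_mulVec_comm_of_transpose_eq hWt u y] at h1
    simp only [smul_eq_mul] at h1
    rw [dotProduct_comm (W *ᵥ y), dotProduct_mulVec_comm_of_transpose_eq hWt u y]
    nlinarith [mul_le_mul_of_nonneg_left hτ (sq_nonneg t)]

/-- The border of a positive semidefinite matrix lies in the range of the leading block `W`, since
it is orthogonal to the kernel of `W`. -/
lemma exists_mulVec_eq_of_posSemidef_bordered {W : Matrix (Fin n × Fin d) (Fin n × Fin d) ℝ}
    {x : Fin n × Fin d → ℝ} {τ : ℝ} (h : (bordered W x τ).PosSemidef) :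
    ∃ y, W *ᵥ y = x ∧ y ⬝ᵥ W *ᵥ y ≤ τ := by
  have hform : ∀ u t, 0 ≤ u ⬝ᵥ W *ᵥ u + 2 * t * (x ⬝ᵥ u) + t ^ 2 * τ := fun u t => by
    rw [← sumElim_dotProduct_bordered_mulVec]
    simpa using h.dotProduct_mulVec_nonneg (Sum.elim u fun _ => t)
  have hWt : Wᵀ = W := by
    ext p q
    exact congrFun (congrFun h.isHermitian.eq (Sum.inl p)) (Sum.inl q)
  have hker : ∀ u, W *ᵥ u = 0 → x ⬝ᵥ u = 0 := fun u hu => by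
    have h1 : ∀ s : ℝ, 0 ≤ 2 * s * (x ⬝ᵥ u) + τ := fun s => by
      simpa [mulVec_smul, hu, mul_assoc] using hform (s • u) 1
    by_contra hne
    -- This `s` makes the affine function in `h1` equal to `-1`.
    have := h1 (-(τ + 1) / (2 * (x ⬝ᵥ u)))
    have h2 : 2 * (-(τ + 1) / (2 * (x ⬝ᵥ u))) * (x ⬝ᵥ u) = -(τ + 1) := by field_simp
    linarith
  have hx : x ∈ LinearMap.range W.mulVecLin := by
    by_contra hx
    obtain ⟨f, hfx, hf⟩ := Submodule.exists_le_ker_of_notMem hx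
    obtain ⟨v, rfl⟩ := (dotProductEquiv ℝ (Fin n × Fin d)).surjective f
    refine hfx ?_
    have hv : W *ᵥ v = 0 := by
      refine dotProduct_eq_zero _ fun u => ?_
      have := hf ⟨u, rfl⟩
      simp only [LinearMap.mem_ker, dotProductEquiv_apply_apply, mulVecLin_apply] at this
      rwa [dotProduct_comm, dotProduct_mulVec_comm_of_transpose_eq hWt]
    simpa [dotProduct_comm] using hker v hv
  obtain ⟨y, rfl⟩ := hx
  refine ⟨y, rfl, ?_⟩
  have := hform y (-1)
  rw [mulVecLin_apply, dotProduct_comm (W *ᵥ y)] at this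
  linarith

/-! ### The extended formulation -/

lemma inflow_congr {f w : Fin (n + 2) → Fin (n + 2) → ℝ} (h : ∀ a b, a < b → f a b = w a b)
    (l : Fin (n + 2)) : inflow f l = inflow w l :=
  Finset.sum_congr rfl fun i hi => h i l (Finset.mem_Iio.mp hi)

lemma flowMatrix_congr (U V : Fin n → Matrix (Fin d) (Fin d) ℝ)
    {f w : Fin (n + 2) → Fin (n + 2) → ℝ} (h : ∀ a b, a < b → f a b = w a b) :
    flowMatrix U V f = flowMatrix U V w := by
  unfold flowMatrix
  refine Finset.sum_congr rfl fun i _ => ?_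
  rw [h _ _ (node_lt_last i)]
  congr 1
  refine Finset.sum_congr rfl fun j hj => ?_
  rw [h _ _ (node_lt_node.mpr (Finset.mem_Ioi.mp hj))]

lemma IsPathFlow.inflow_node {w : Fin (n + 2) → Fin (n + 2) → ℝ} (h : IsPathFlow w) (i : Fin n) :
    inflow w (node i) = outflow w (node i) := by
  have := h.2 (node i)
  rw [if_neg (zero_lt_node i).ne', if_neg (node_lt_last i).ne] at this
  exact sub_eq_zero.mp this

lemma convex_setOf_isPathFlow : Convex ℝ {w : Fin (n + 2) → Fin (n + 2) → ℝ | IsPathFlow w} := by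
  rintro w hw w' hw' a b ha hb hab
  refine ⟨fun i j hij => ?_, fun l => ?_⟩
  · have := hw.1 i j hij
    have := hw'.1 i j hij
    simp only [Pi.add_apply, Pi.smul_apply, smul_eq_mul]
    positivity
  · rw [inflow_add, outflow_add, inflow_smul, inflow_smul, outflow_smul, outflow_smul]
    have h1 := hw.2 l
    have h2 := hw'.2 l
    generalize (if l = 0 then (-1 : ℝ) else if l = Fin.last (n + 1) then 1 else 0) = c at *
    calc _ = a * (inflow w l - outflow w l) + b * (inflow w' l - outflow w' l) := by ring
      _ = (a + b) * c := by rw [h1, h2]; ring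
      _ = c := by rw [hab, one_mul]

lemma isPathFlow_of_mem_convexHull {w : Fin (n + 2) → Fin (n + 2) → ℝ}
    (h : w ∈ convexHull ℝ {w | IsPath 0 w}) : IsPathFlow w :=
  convexHull_min (fun _ hw => IsPath.isPathFlow hw) convex_setOf_isPathFlow h

/-- The set described by the extended formulation, with the flow confined to the path polytope. -/
def pathFormulation (U V : Fin n → Matrix (Fin d) (Fin d) ℝ) :
    Set ((Fin n × Fin d → ℝ) × (Fin n → ℝ) × ℝ) :=
  {p | ∃ w ∈ convexHull ℝ {w : Fin (n + 2) → Fin (n + 2) → ℝ | IsPath 0 w},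
    (bordered (flowMatrix U V w) p.1 p.2.2).PosSemidef ∧ ∀ i, p.2.1 i = inflow w (node i)}

lemma continuous_flowMatrix (U V : Fin n → Matrix (Fin d) (Fin d) ℝ) :
    Continuous (flowMatrix U V) := by
  unfold flowMatrix
  fun_prop

lemma continuous_inflow (l : Fin (n + 2)) : Continuous fun w => inflow w l := by
  unfold inflow
  fun_prop

lemma isClosed_setOf_posSemidef {m : Type*} [Fintype m] :
    IsClosed {A : Matrix m m ℝ | A.PosSemidef} := by
  simp only [posSemidef_iff_dotProduct_mulVec, Set.ofPred_and, Set.ofPred_forall]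
  refine IsClosed.inter ?_ (isClosed_iInter fun v => ?_)
  · exact isClosed_eq (by fun_prop) continuous_id
  · exact isClosed_le continuous_const (by fun_prop)

/-- The formulation is closed: it is a projection along the path polytope, which is compact. -/
lemma isClosed_pathFormulation (U V : Fin n → Matrix (Fin d) (Fin d) ℝ) :
    IsClosed (pathFormulation U V) := by
  let K := convexHull ℝ {w : Fin (n + 2) → Fin (n + 2) → ℝ | IsPath 0 w}
  have hK : IsCompact K := (setOf_isPath_finite 0).isCompact_convexHull (𝕜 := ℝ)
  have : CompactSpace K := isCompact_iff_compactSpace.mp hK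
  let F : Set (((Fin n × Fin d → ℝ) × (Fin n → ℝ) × ℝ) × K) :=
    {q | (bordered (flowMatrix U V q.2.1) q.1.1 q.1.2.2).PosSemidef} ∩
      ⋂ i, {q | q.1.2.1 i = inflow q.2.1 (node i)}
  have hF : IsClosed F := by
    refine IsClosed.inter (isClosed_setOf_posSemidef.preimage ?_) (isClosed_iInter fun i => ?_)
    · unfold bordered
      refine Continuous.matrix_fromBlocks ?_ ?_ ?_ ?_
      · exact (continuous_flowMatrix U V).comp (by fun_prop)
      · exact continuous_matrix fun i j => by simp only [replicateCol_apply]; fun_prop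
      · exact continuous_matrix fun i j => by simp only [replicateRow_apply]; fun_prop
      · exact continuous_matrix fun i j => by simp only [of_apply]; fun_prop
    · exact isClosed_eq (by fun_prop) ((continuous_inflow _).comp (by fun_prop))
  convert isClosedMap_fst_of_compactSpace F hF using 1
  ext p
  constructor
  · rintro ⟨w, hw, hpsd, hz⟩
    exact ⟨(p, ⟨w, hw⟩), ⟨hpsd, Set.mem_iInter.mpr hz⟩, rfl⟩
  · rintro ⟨⟨p, w, hw⟩, ⟨hpsd, hz⟩, rfl⟩
    exact ⟨w, hw, hpsd, Set.mem_iInter.mp hz⟩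

lemma convex_pathFormulation (U V : Fin n → Matrix (Fin d) (Fin d) ℝ) :
    Convex ℝ (pathFormulation U V) := by
  rintro ⟨x, z, τ⟩ ⟨w, hw, hpsd, hz⟩ ⟨x', z', τ'⟩ ⟨w', hw', hpsd', hz'⟩ a b ha hb hab
  refine ⟨a • w + b • w', convex_convexHull ℝ _ hw hw' ha hb hab, ?_, fun i => ?_⟩
  · convert (hpsd.smul ha).add (hpsd'.smul hb) using 1
    rw [flowMatrix_add, flowMatrix_smul, flowMatrix_smul]
    ext (i | i) (j | j) <;> simp [bordered]
  · have h1 := hz i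
    have h2 := hz' i
    simp only at h1 h2
    simp [inflow_add, inflow_smul, h1, h2]

section Formulation

variable {Q : Matrix (Fin n × Fin d) (Fin n × Fin d) ℝ} {U V : Fin n → Matrix (Fin d) (Fin d) ℝ}

/-- For `x` supported on the blocks of a path with matrix `M`, the border is `x = M (Q x)`, and
`x ⬝ᵥ Q *ᵥ x` is the value of the quadratic form of `M` at `Q x`. -/
lemma mixedIntegerSet_subset_pathFormulation (hQ : Q.PosDef) (hUV : IsBlockFactorization Q U V) :
    mixedIntegerSet Q ⊆ pathFormulation U V := by
  rintro ⟨x, z, τ⟩ ⟨hz, _, hxτ, hxz⟩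
  simp only at hz hxτ hxz
  obtain ⟨w, hw, hwz⟩ :=
    exists_isPath_outflow_eq ((Finset.univ.filter fun i => z i = 1).image node) 0
  have hz' : ∀ i, z i = outflow w (node i) := fun i => by
    rw [hwz _ (zero_lt_node i) (node_lt_last i).ne]
    rcases hz i with h | h <;> simp [h, node_inj]
  have hinv := hw.isPaddedInverse hQ hUV
  have hDx : (diagonal fun p : Fin n × Fin d => outflow w (node p.1)) *ᵥ x = x := by
    ext p
    rw [mulVec_diagonal, ← hz']
    linarith [hxz p.1 p.2]
  have hMQx : flowMatrix U V w *ᵥ (Q *ᵥ x) = x := by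
    conv_lhs => rw [← hDx, mulVec_mulVec, mulVec_mulVec, hinv.mul_mul_supp]
    exact hDx
  have hpsd : (flowMatrix U V w).PosSemidef := by
    have := hQ.posSemidef.conjTranspose_mul_mul_same (flowMatrix U V w)
    rwa [conjTranspose_eq_transpose_of_trivial, hinv.transpose_eq, hinv.mul_mul_self] at this
  refine ⟨w, subset_convexHull ℝ _ hw, ?_, fun i => ?_⟩
  · have := posSemidef_bordered_mulVec hpsd (Q *ᵥ x) (τ := τ)
      (by rwa [hMQx, dotProduct_comm])
    rwa [hMQx] at this
  · exact (hz' i).trans (hw.isPathFlow.inflow_node i).symm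

lemma IsPath.mem_mixedIntegerSet (hQ : Q.PosDef) (hUV : IsBlockFactorization Q U V)
    {w : Fin (n + 2) → Fin (n + 2) → ℝ} (hw : IsPath 0 w) (y : Fin n × Fin d → ℝ) {s : ℝ}
    (hs : 0 ≤ s) :
    (flowMatrix U V w *ᵥ y, (fun i => outflow w (node i)), y ⬝ᵥ flowMatrix U V w *ᵥ y + s) ∈
      mixedIntegerSet Q := by
  have hinv := hw.isPaddedInverse hQ hUV
  have h1 : (flowMatrix U V w *ᵥ y) ⬝ᵥ (Q *ᵥ (flowMatrix U V w *ᵥ y)) =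
      y ⬝ᵥ flowMatrix U V w *ᵥ y := by
    rw [dotProduct_comm, dotProduct_mulVec_comm_of_transpose_eq hinv.transpose_eq, mulVec_mulVec,
      mulVec_mulVec, hinv.mul_mul_self]
  have h2 : 0 ≤ y ⬝ᵥ flowMatrix U V w *ᵥ y := by
    rw [← h1]
    simpa using hQ.posSemidef.dotProduct_mulVec_nonneg (flowMatrix U V w *ᵥ y)
  refine ⟨fun i => hw.outflow_binary (node i), add_nonneg h2 hs, ?_, fun i k => ?_⟩
  · simp only [h1]
    linarith
  · have h3 : (flowMatrix U V w *ᵥ y) (i, k) =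
        outflow w (node i) * (flowMatrix U V w *ᵥ y) (i, k) := by
      conv_lhs => rw [← hinv.supp_mul, ← mulVec_mulVec, mulVec_diagonal]
    change (flowMatrix U V w *ᵥ y) (i, k) * (1 - outflow w (node i)) = 0
    linear_combination h3

/-- With the border written as `W *ᵥ y`, the triple depends affinely on the flow for fixed `y` and
fixed slack `s`, so a decomposition of the flow into paths decomposes the triple. -/
lemma pathFormulation_subset_convexHull (hQ : Q.PosDef) (hUV : IsBlockFactorization Q U V) :
    pathFormulation U V ⊆ convexHull ℝ (mixedIntegerSet Q) := by
  rintro ⟨x, z, τ⟩ ⟨w, hw, hpsd, hz⟩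
  simp only at hpsd hz
  obtain ⟨y, rfl, hy⟩ := exists_mulVec_eq_of_posSemidef_bordered hpsd
  let L : (Fin (n + 2) → Fin (n + 2) → ℝ) → (Fin n × Fin d → ℝ) × (Fin n → ℝ) × ℝ := fun f =>
    (flowMatrix U V f *ᵥ y, (fun i => outflow f (node i)), y ⬝ᵥ flowMatrix U V f *ᵥ y)
  have hL : IsLinearMap ℝ L := by
    constructor
    · intro f g
      simp only [L, flowMatrix_add, add_mulVec, outflow_add, dotProduct_add]
      rfl
    · intro c f
      simp only [L, flowMatrix_smul, smul_mulVec, outflow_smul, dotProduct_smul]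
      rfl
  have hconv := ((convex_convexHull ℝ (mixedIntegerSet Q)).translate_preimage_left
    ((0 : Fin n × Fin d → ℝ), (0 : Fin n → ℝ),
      τ - y ⬝ᵥ flowMatrix U V w *ᵥ y)).is_linear_preimage hL
  have hmem := convexHull_min (fun f hf => ?_) hconv hw
  · have hzw : z = fun i => outflow w (node i) := by
      ext i
      rw [hz, (isPathFlow_of_mem_convexHull hw).inflow_node]
    simpa [L, hzw] using hmem
  · have := subset_convexHull ℝ _
      (IsPath.mem_mixedIntegerSet hQ hUV hf y (sub_nonneg.mpr hy))
    simpa [L] using this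

end Formulation

end BlockFactorizable

theorem mainTheorem1 (n d : ℕ) (Q : Matrix (Fin n × Fin d) (Fin n × Fin d) ℝ)
    (U V : Fin n → Matrix (Fin d) (Fin d) ℝ)
    (hQ : Q.PosDef) (hUV : BlockFactorizable.IsBlockFactorization Q U V) :
    closure (convexHull ℝ (BlockFactorizable.mixedIntegerSet Q)) =
      {p : (Fin n × Fin d → ℝ) × (Fin n → ℝ) × ℝ |
        ∃ (W : Matrix (Fin n × Fin d) (Fin n × Fin d) ℝ) (w : Fin (n + 2) → Fin (n + 2) → ℝ),
          (BlockFactorizable.bordered W p.1 p.2.2).PosSemidef ∧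
          BlockFactorizable.IsPathFlow w ∧
          (∀ i : Fin n, p.2.1 i = BlockFactorizable.inflow w (BlockFactorizable.node i)) ∧
          W = BlockFactorizable.flowMatrix U V w} := by
  have h : convexHull ℝ (BlockFactorizable.mixedIntegerSet Q) =
      BlockFactorizable.pathFormulation U V :=
    (convexHull_min (BlockFactorizable.mixedIntegerSet_subset_pathFormulation hQ hUV)
      (BlockFactorizable.convex_pathFormulation U V)).antisymm
      (BlockFactorizable.pathFormulation_subset_convexHull hQ hUV)
  rw [h, (BlockFactorizable.isClosed_pathFormulation U V).closure_eq]
  ext p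
  constructor
  · rintro ⟨w, hw, hpsd, hz⟩
    exact ⟨_, w, hpsd, BlockFactorizable.isPathFlow_of_mem_convexHull hw, hz, rfl⟩
  · rintro ⟨_, w, hpsd, hw, hz, rfl⟩
    obtain ⟨f, hf, hfw⟩ := hw.exists_mem_convexHull
    refine ⟨f, hf, ?_, fun i => ?_⟩
    · rwa [BlockFactorizable.flowMatrix_congr U V hfw]
    · rw [hz, BlockFactorizable.inflow_congr hfw]
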